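/- For a prime $p$ let $\mathbb Q_p$, $\mathbb Z_p$ be the $p$-adic numbers and integers. Let $\mathbb A=\mathbb A_{\mathrm{fin}}\times\mathbb R$ be the adele ring of $\mathbb Q$, where $\mathbb A_{\mathrm{fin}}=\prod_p(\mathbb Q_p:\mathbb Z_p)$ is the restricted product over all primes. Embed $\mathbb Q$ diagonally in $\mathbb A$. Let $\mathbb I=\mathbb A^\times$ be the idele group, and for $x\in\mathbb I$ put $|x|_{\mathbb A}=\prod_{p\le\infty}|x_p|_p$. Let $\mu_{\mathbb A}=\prod_{p\le\infty}dx_p$ be the Haar measure on $\mathbb A$, that is, the product of the Haar measure on $\mathbb A_{\mathrm{fin}}$ giving $\prod_p\mathbb Z_p$ volume $1$ and Lebesgue measure on $\mathbb R$. Let $\chi_{\mathbb Q}=\prod_{p\le\infty}\chi_p:\mathbb A\to\mathbb C$ be the standard character, with $\chi_\infty(x)=e^{-2\pi\sqrt{-1}\,x}$ for $x\in\mathbb R$ and $\chi_p(x)=e^{2\pi\sqrt{-1}\,\{x\}_p}$ for $x\in\mathbb Q_p$, where $\{x\}_p=\sum_{n<0}a_np^n\in\mathbb Q$ is the fractional part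 of $x=\sum_n a_np^n$ ($a_n\in\{0,\dots,p-1\}$). The Bruhat–Schwartz space $\mathcal B_\infty(\mathbb A)$ consists of the finite complex linear combinations of functions $f(x)=\prod_p f_p(x_p)\cdot f_\infty(x_\infty)$, where $f_\infty$ is a Schwartz function on $\mathbb R$, each $f_p:\mathbb Q_p\to\mathbb C$ is locally constant with compact support, and $f_p$ is the characteristic function of $\mathbb Z_p$ for all but finitely many $p$. Let $f\in\mathcal B_\infty(\mathbb A)$. Then $f$ is $\mu_{\mathbb A}$-integrable, and its Fourier transform $\widehat f(t)=\int_{\mathbb A}f(x)\chi_{\mathbb Q}(tx)\,d\mu_{\mathbb A}(x)$ $(t\in\mathbb A)$ satisfies the following. 1. (Poisson summation formula) The series below converge absolutely, and $$\sum_{r\in\mathbb Q}f(r)=\sum_{q\in\mathbb Q}\widehat f(q).$$ 2. For every idele $x\in\mathbb I$ the series below converge absolutely, and $$\sum_{r\in\mathbb Q}f(rx)=\frac1{|x|_{\mathbb A}}\sum_{q\in\mathbb Q}\widehat f(qx^{-1}).$$ -/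

import Mathlib

open MeasureTheory Filter Topology
open scoped RestrictedProduct SchwartzMap

namespace Adelic

noncomputable section

instance instFactPrime (p : Nat.Primes) : Fact (p : ℕ).Prime := ⟨p.2⟩

/-! ### Adeles and ideles of `ℚ` -/

/-- The finite adeles: the restricted product of the fields `ℚ_p` with respect to the rings `ℤ_p`,
`p` running over all primes, with the restricted product topology. -/
abbrev FinAdele : Type := Πʳ p : Nat.Primes, [ℚ_[(p : ℕ)], PadicInt.subring (p : ℕ)]

/-- The adele ring of `ℚ`: finite adeles times `ℝ`. -/
abbrev Adele : Type := FinAdele × ℝ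

/-- The idele group, as the group of units of the adele ring. -/
abbrev Idele : Type := Adeleˣ

theorem isOpen_padicInt (p : ℕ) [Fact p.Prime] :
    IsOpen ((PadicInt.subring p : Subring ℚ_[p]) : Set ℚ_[p]) := by
  have h : ((PadicInt.subring p : Subring ℚ_[p]) : Set ℚ_[p]) = Metric.closedBall 0 1 := by
    ext x
    simp [PadicInt.subring]
  rw [h]
  exact IsUltrametricDist.isOpen_closedBall 0 one_ne_zero

theorem isCompact_padicInt (p : ℕ) [Fact p.Prime] :
    IsCompact ((PadicInt.subring p : Subring ℚ_[p]) : Set ℚ_[p]) := by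
  have h : ((PadicInt.subring p : Subring ℚ_[p]) : Set ℚ_[p]) = Metric.closedBall 0 1 := by
    ext x
    simp [PadicInt.subring]
  rw [h]
  exact isCompact_closedBall 0 1

instance instFactOpen : Fact (∀ p : Nat.Primes,
    IsOpen ((PadicInt.subring (p : ℕ) : Subring ℚ_[(p : ℕ)]) : Set ℚ_[(p : ℕ)])) :=
  ⟨fun p => isOpen_padicInt (p : ℕ)⟩

/-- A rational number is a `p`-adic integer for all but finitely many primes `p`. -/
theorem eventually_ratCast_mem (q : ℚ) :
    ∀ᶠ p : Nat.Primes in cofinite,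
      (q : ℚ_[(p : ℕ)]) ∈ (PadicInt.subring (p : ℕ) : Subring ℚ_[(p : ℕ)]) := by
  have hfin : {p : Nat.Primes | (p : ℕ) ∣ q.den}.Finite := by
    refine Set.Finite.of_finite_image (f := fun p : Nat.Primes => (p : ℕ)) ?_
      Subtype.val_injective.injOn
    refine (Nat.divisors q.den).finite_toSet.subset ?_
    rintro _ ⟨p, hp, rfl⟩
    simpa using (⟨hp, q.den_nz⟩ : (p : ℕ) ∣ q.den ∧ q.den ≠ 0)
  filter_upwards [hfin.compl_mem_cofinite] with p hp
  exact Padic.norm_rat_le_one hp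

/-- The diagonal embedding of `ℚ` into the adele ring. -/
def diag : ℚ →+* Adele where
  toFun q := (⟨fun p => (q : ℚ_[(p : ℕ)]), eventually_ratCast_mem q⟩, (q : ℝ))
  map_one' := by
    refine Prod.ext (RestrictedProduct.ext _ _ fun p => ?_) ?_ <;> simp
  map_zero' := by
    refine Prod.ext (RestrictedProduct.ext _ _ fun p => ?_) ?_ <;> simp
  map_add' a b := by
    refine Prod.ext (RestrictedProduct.ext _ _ fun p => Rat.cast_add a b) ?_
    simp
  map_mul' a b := by
    refine Prod.ext (RestrictedProduct.ext _ _ fun p => Rat.cast_mul a b) ?_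
    simp

/-- The idelic absolute value `|x|_𝔸 = ∏_{p ≤ ∞} |x_p|_p`
(all but finitely many factors are equal to `1`). -/
def ideleAbs (x : Idele) : ℝ :=
  (∏ᶠ p : Nat.Primes, ‖(x : Adele).1 p‖) * |(x : Adele).2|

/-! ### Haar measure -/

instance instMeasurableSpaceFinAdele : MeasurableSpace FinAdele := borel FinAdele

instance instBorelSpaceFinAdele : BorelSpace FinAdele := ⟨rfl⟩

/-- The subset `∏_p ℤ_p` of the finite adeles. -/
def integralAdeles : Set FinAdele :=
  {x | ∀ p : Nat.Primes, x p ∈ (PadicInt.subring (p : ℕ) : Subring ℚ_[(p : ℕ)])}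

theorem isOpen_integralAdeles : IsOpen integralAdeles :=
  RestrictedProduct.isOpen_forall_mem fun p : Nat.Primes => isOpen_padicInt (p : ℕ)

theorem isCompact_integralAdeles : IsCompact integralAdeles := by
  have h := RestrictedProduct.range_structureMap (𝓕 := cofinite)
    (R := fun p : Nat.Primes => ℚ_[(p : ℕ)])
    (A := fun p : Nat.Primes =>
      ((PadicInt.subring (p : ℕ) : Subring ℚ_[(p : ℕ)]) : Set ℚ_[(p : ℕ)]))
  have h' : integralAdeles = Set.range (RestrictedProduct.structureMap
      (fun p : Nat.Primes => ℚ_[(p : ℕ)])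
      (fun p : Nat.Primes =>
        ((PadicInt.subring (p : ℕ) : Subring ℚ_[(p : ℕ)]) : Set ℚ_[(p : ℕ)])) cofinite) :=
    h.symm
  have hc : ∀ p : Nat.Primes, CompactSpace
      ((PadicInt.subring (p : ℕ) : Subring ℚ_[(p : ℕ)]) : Set ℚ_[(p : ℕ)]) := fun p =>
    isCompact_iff_compactSpace.mp (isCompact_padicInt (p : ℕ))
  rw [h']
  exact isCompact_range RestrictedProduct.isEmbedding_structureMap.continuous

/-- `∏_p ℤ_p` as a compact set with nonempty interior. -/
def integralPositiveCompacts : TopologicalSpace.PositiveCompacts FinAdele where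
  carrier := integralAdeles
  isCompact' := isCompact_integralAdeles
  interior_nonempty' := by
    rw [isOpen_integralAdeles.interior_eq]
    exact ⟨0, fun p : Nat.Primes => (PadicInt.subring (p : ℕ)).zero_mem⟩

/-- The Haar measure on the finite adeles that gives `∏_p ℤ_p` volume `1`. -/
def finHaar : Measure FinAdele := Measure.addHaarMeasure integralPositiveCompacts

/-- The Haar measure `∏_{p ≤ ∞} dx_p` on the adeles: the product of the Haar measure on the finite
adeles with total mass `1` on `∏_p ℤ_p` and of Lebesgue measure on `ℝ`. -/
def adeleHaar : Measure Adele := finHaar.prod volume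

/-! ### The standard character -/

section Padic

variable (p : ℕ) [Fact p.Prime]

theorem norm_pow_mul_le_one (x : ℚ_[p]) : ‖(p : ℚ_[p]) ^ (-x.valuation).toNat * x‖ ≤ 1 := by
  have hp : (1 : ℝ) < p := by exact_mod_cast (Fact.out : p.Prime).one_lt
  rcases eq_or_ne x 0 with rfl | hx
  · simp
  · rw [norm_mul, norm_pow, Padic.norm_p, Padic.norm_eq_zpow_neg_valuation hx, inv_pow,
      ← zpow_natCast, ← zpow_neg, ← zpow_add₀ (by positivity)]
    refine zpow_le_one_of_nonpos₀ hp.le ?_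
    have := Int.self_le_toNat (-x.valuation)
    omega

/-- The `p`-adic integer `pᵏ x`, where `k = max (-v(x)) 0`. -/
def padicScale (x : ℚ_[p]) : ℤ_[p] :=
  ⟨(p : ℚ_[p]) ^ (-x.valuation).toNat * x, norm_pow_mul_le_one p x⟩

/-- The fractional part `{x}_p = ∑_{n < 0} aₙ pⁿ` of a `p`-adic number `x = ∑ₙ aₙ pⁿ` with digits
`0 ≤ aₙ < p`. Put `k = max (-v(x)) 0`. The first `k` digits of the `p`-adic integer `pᵏ x` make up
the natural number `PadicInt.appr (pᵏ x) k = ∑_{0 ≤ n < k} a_{n-k} pⁿ`, which is divided by `pᵏ`. -/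
def padicFract (x : ℚ_[p]) : ℚ :=
  (PadicInt.appr (padicScale p x) (-x.valuation).toNat : ℚ) / (p : ℚ) ^ (-x.valuation).toNat

/-- The character `χ_p(x) = exp(2πi {x}_p)` of `ℚ_p`. -/
def padicChar (x : ℚ_[p]) : ℂ :=
  Complex.exp (2 * Real.pi * Complex.I * (padicFract p x : ℂ))

end Padic

/-- The character `χ_∞(x) = exp(-2πi x)` of `ℝ`. -/
def realChar (x : ℝ) : ℂ := Complex.exp (-2 * Real.pi * Complex.I * (x : ℂ))

/-- The standard character `χ_ℚ = ∏_{p ≤ ∞} χ_p` of the adeles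
(all but finitely many factors are equal to `1`). -/
def stdChar (x : Adele) : ℂ := (∏ᶠ p : Nat.Primes, padicChar (p : ℕ) (x.1 p)) * realChar x.2

/-! ### Bruhat-Schwartz functions and the Fourier transform -/

/-- The Bruhat space of the finite adeles: finite linear combinations of functions `∏_p f_p`, where
each `f_p : ℚ_p → ℂ` is locally constant with compact support and `f_p` is the characteristic
function of `ℤ_p` for all but finitely many `p`. -/
def bruhat : Submodule ℂ (FinAdele → ℂ) :=
  Submodule.span ℂ {φ | ∃ f : ∀ p : Nat.Primes, ℚ_[(p : ℕ)] → ℂ,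
    (∀ p, IsLocallyConstant (f p) ∧ HasCompactSupport (f p)) ∧
    (∀ᶠ p in cofinite, f p =
      Set.indicator ((PadicInt.subring (p : ℕ) : Subring ℚ_[(p : ℕ)]) : Set ℚ_[(p : ℕ)]) 1) ∧
    φ = fun x => ∏ᶠ p : Nat.Primes, f p (x p)}

/-- The Bruhat-Schwartz space of the adeles: finite linear combinations of functions
`x ↦ φ(x_fin) g(x_∞)` with `φ` in the Bruhat space of the finite adeles and `g` a Schwartz function
on `ℝ`. -/
def bruhatSchwartz : Submodule ℂ (Adele → ℂ) :=
  Submodule.span ℂ {f | ∃ φ ∈ bruhat, ∃ g : 𝓢(ℝ, ℂ), f = fun x => φ x.1 * g x.2}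

/-- The Fourier transform `f̂(t) = ∫ f(x) χ_ℚ(t x) dx` on the adeles. -/
def fourier (f : Adele → ℂ) (t : Adele) : ℂ := ∫ x, f x * stdChar (t * x) ∂adeleHaar

end

end Adelic

/-! Everything reduces to classical Poisson summation on `ℝ`. Local constancy and compact support
make a pure tensor in `bruhat` invariant under `N ∏_p ℤ_p` and supported in `N⁻¹ ∏_p ℤ_p` for some
`N > 0`, so it is a finite combination of indicators of cosets `a + N ∏_p ℤ_p` with `a` rational
(`exists_level`, `eq_sum_indicator_coset`). Both sides of the formula are linear in `f`, which
leaves the tensor of one such indicator with a Schwartz function `g`.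

The finite character has kernel exactly `∏_p ℤ_p`; hence the transform of the indicator is `N⁻¹ χ(t
a)` when `N t` is integral and zero otherwise. The finite part of an idele is a positive rational
`q` times a unit of `∏_p ℤ_p` (`exists_rat_idele`), and strong approximation (`exists_rat_add_mul`)
replaces the translate of `a` by that unit with a rational `b`. The rationals that contribute then
form the progression `(b + N ℤ)/q` on the left and the lattice `(q/N) ℤ` on the right, and
`poisson_arithmetic_progression` equates the two sums (`poissonAt_cosetTensor`). -/

namespace Adelic

noncomputable section

/-! ### Arithmetic of the finite adeles -/

/-- The diagonal embedding of `ℚ` into the finite adeles. -/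
def finDiag : ℚ →+* FinAdele := (RingHom.fst FinAdele ℝ).comp diag

@[simp] theorem finDiag_apply (q : ℚ) (p : Nat.Primes) : finDiag q p = (q : ℚ_[(p : ℕ)]) := rfl

theorem diag_snd (q : ℚ) : (diag q).2 = (q : ℝ) := rfl

/-- The ring `∏_p ℤ_p` of integral finite adeles. -/
def integralSubring : Subring FinAdele where
  carrier := integralAdeles
  mul_mem' hx hy p := mul_mem (hx p) (hy p)
  one_mem' p := one_mem (PadicInt.subring (p : ℕ))
  add_mem' hx hy p := add_mem (hx p) (hy p)
  zero_mem' p := zero_mem (PadicInt.subring (p : ℕ))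
  neg_mem' hx p := neg_mem (hx p)

theorem mem_integralSubring_iff {x : FinAdele} : x ∈ integralSubring ↔ ∀ p, ‖x p‖ ≤ 1 := Iff.rfl

theorem eventually_norm_le_one (x : FinAdele) : ∀ᶠ p in cofinite, ‖x p‖ ≤ 1 := x.2

theorem finDiag_intCast_mem (n : ℤ) : finDiag n ∈ integralSubring := by
  simp

theorem finDiag_natCast_mem (n : ℕ) : finDiag n ∈ integralSubring := by
  simp

/-- A prime dividing the denominator does not divide the numerator, so it would force `|q|_p > 1`.
-/
theorem exists_intCast_of_finDiag_mem {q : ℚ} (h : finDiag q ∈ integralSubring) :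
    ∃ n : ℤ, q = n := by
  refine ⟨q.num, ?_⟩
  suffices hd : q.den = 1 from (Rat.coe_int_num_of_den_eq_one hd).symm
  by_contra hd
  obtain ⟨p, hp, hdvd⟩ := Nat.exists_prime_and_dvd hd
  have : Fact p.Prime := ⟨hp⟩
  have h1 : ‖(q : ℚ_[p])‖ ≤ 1 := h ⟨p, hp⟩
  have hnum : ‖(q.num : ℚ_[p])‖ = 1 := by
    refine le_antisymm (Padic.norm_int_le_one _) (not_lt.1 fun hlt => ?_)
    rw [Padic.norm_intCast_lt_one_iff] at hlt
    have := Nat.dvd_gcd (Int.natCast_dvd.1 hlt) hdvd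
    rw [q.reduced] at this
    exact hp.one_lt.ne' (Nat.dvd_one.1 this)
  have hden : ‖(q.den : ℚ_[p])‖ < 1 := by
    rw [Padic.norm_natCast_lt_one_iff]; exact hdvd
  have hmul : (q : ℚ_[p]) * q.den = q.num := by
    exact_mod_cast congrArg (Rat.cast (K := ℚ_[p])) (Rat.mul_den_eq_num q)
  have := congrArg norm hmul
  rw [norm_mul, hnum] at this
  nlinarith [norm_nonneg (q : ℚ_[p]), norm_nonneg (q.den : ℚ_[p])]

theorem norm_cast_prime (p l : Nat.Primes) :
    ‖((p : ℕ) : ℚ_[(l : ℕ)])‖ = if l = p then ((l : ℕ) : ℝ)⁻¹ else 1 := by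
  split_ifs with h
  · subst h; exact Padic.norm_p
  · rw [Padic.norm_natCast_eq_one_iff]
    exact (Nat.coprime_primes l.2 p.2).2 fun h' => h (Subtype.ext h')

theorem norm_prod_zpow (S : Finset Nat.Primes) (k : Nat.Primes → ℤ) (l : Nat.Primes) :
    ‖((∏ p ∈ S, ((p : ℕ) : ℚ) ^ k p : ℚ) : ℚ_[(l : ℕ)])‖ =
      if l ∈ S then ((l : ℕ) : ℝ) ^ (-k l) else 1 := by
  push_cast
  rw [norm_prod]
  simp_rw [norm_zpow, norm_cast_prime]
  rw [← Finset.prod_ite_eq S l fun p => ((p : ℕ) : ℝ) ^ (-k p)]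
  refine Finset.prod_congr rfl fun p _ => ?_
  split_ifs with h
  · subst h; simp
  · simp

/-- A rational number with prescribed `p`-adic absolute values. -/
theorem exists_rat_norm_eq (x : FinAdele) (h0 : ∀ p, x p ≠ 0)
    (h1 : ∀ᶠ p in cofinite, ‖x p‖ = 1) :
    ∃ q : ℚ, 0 < q ∧ (∀ p : Nat.Primes, ‖(q : ℚ_[(p : ℕ)])‖ = ‖x p‖) ∧
      ∏ᶠ p : Nat.Primes, ‖x p‖ = (q : ℝ)⁻¹ := by
  set S : Finset Nat.Primes := (show Set.Finite {p | ¬ ‖x p‖ = 1} from h1).toFinset with hS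
  have hmem : ∀ p, p ∉ S → ‖x p‖ = 1 := fun p hp => by
    simpa [hS] using hp
  -- The exponents are the valuations of `x`, nonzero only on the finite set `S`; the last claim is
  -- the product formula for this rational.
  refine ⟨∏ p ∈ S, ((p : ℕ) : ℚ) ^ (x p).valuation,
    Finset.prod_pos fun p _ => zpow_pos (by exact_mod_cast p.2.pos) _, fun p => ?_, ?_⟩
  · rw [norm_prod_zpow]
    split_ifs with h
    · exact (Padic.norm_eq_zpow_neg_valuation (h0 p)).symm
    · exact (hmem p h).symm
  · rw [finprod_eq_prod_of_mulSupport_subset (s := S)]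
    · push_cast
      rw [← Finset.prod_inv_distrib]
      refine Finset.prod_congr rfl fun p _ => ?_
      rw [Padic.norm_eq_zpow_neg_valuation (h0 p), zpow_neg]
    · intro p hp
      by_contra h
      exact hp (hmem p h)

/-- A common denominator for a family of bounds almost all of which are at most one. -/
theorem exists_nat_mul_norm_le_one (b : Nat.Primes → ℝ) (hb : ∀ᶠ p in cofinite, b p ≤ 1) :
    ∃ N : ℕ, 0 < N ∧ ∀ p : Nat.Primes, b p * ‖(N : ℚ_[(p : ℕ)])‖ ≤ 1 := by
  set S : Finset Nat.Primes := (show Set.Finite {p | ¬ b p ≤ 1} from hb).toFinset with hS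
  have hmem : ∀ p, p ∈ S ↔ ¬ b p ≤ 1 := fun p => by simp [hS]
  have hk : ∀ p : Nat.Primes, ∃ k : ℕ, b p < ((p : ℕ) : ℝ) ^ k := fun p =>
    pow_unbounded_of_one_lt _ (by exact_mod_cast p.2.one_lt)
  choose k hk using hk
  refine ⟨∏ p ∈ S, (p : ℕ) ^ k p, Finset.prod_pos fun p _ => pow_pos p.2.pos _, fun p => ?_⟩
  have h := norm_prod_zpow S (fun p => k p) p
  have h' : ((∏ p ∈ S, (p : ℕ) ^ k p : ℕ) : ℚ_[(p : ℕ)]) =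
      ((∏ p ∈ S, ((p : ℕ) : ℚ) ^ (k p : ℤ) : ℚ) : ℚ_[(p : ℕ)]) := by
    push_cast; simp
  rw [h', h]
  have hp : (0 : ℝ) < ((p : ℕ) : ℝ) ^ k p := pow_pos (by exact_mod_cast p.2.pos) _
  split_ifs with hpS
  · rw [zpow_neg, zpow_natCast, ← div_eq_mul_inv, div_le_one hp]
    exact (hk p).le
  · rw [mul_one]
    exact not_not.1 (mt (hmem p).2 hpS)

theorem exists_nat_mul_mem (x : FinAdele) :
    ∃ N : ℕ, 0 < N ∧ finDiag N * x ∈ integralSubring := by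
  obtain ⟨N, hN, h⟩ := exists_nat_mul_norm_le_one (fun p => ‖x p‖) (eventually_norm_le_one x)
  refine ⟨N, hN, mem_integralSubring_iff.2 fun p => ?_⟩
  have := h p
  rw [RestrictedProduct.mul_apply, norm_mul, mul_comm, finDiag_apply, Rat.cast_natCast]
  exact this

/-- Integral finite adeles are approximated by integers. -/
theorem exists_int_add_mul (M : ℕ) (hM : 0 < M) (z : FinAdele) (hz : z ∈ integralSubring) :
    ∃ j : ℤ, ∃ w ∈ integralSubring, z = finDiag j + finDiag M * w := by
  -- Induction on the factorisation of `M`: at a prime, the residue field of `ℤ_p` supplies the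
  -- integer and `p` is a unit at the other places; for a product, the two expansions are nested.
  induction M using Nat.recOnMul generalizing z with
  | zero => omega
  | one => exact ⟨0, z, hz, by simp⟩
  | prime p hp =>
    have : Fact p.Prime := ⟨hp⟩
    obtain ⟨n, -, hn⟩ := PadicInt.exists_mem_range (p := p) ⟨z ⟨p, hp⟩, hz ⟨p, hp⟩⟩
    rw [PadicInt.maximalIdeal_eq_span_p, Ideal.mem_span_singleton] at hn
    obtain ⟨c, hc⟩ := hn
    have hp0 : (p : ℚ) ≠ 0 := by exact_mod_cast hp.ne_zero
    refine ⟨n, finDiag (p : ℚ)⁻¹ * (z - finDiag n), mem_integralSubring_iff.2 fun l => ?_, ?_⟩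
    · by_cases h : l = ⟨p, hp⟩
      · subst h
        have hc' : z ⟨p, hp⟩ - ((n : ℚ) : ℚ_[p]) = (p : ℚ_[p]) * c := by
          rw [Rat.cast_natCast]
          exact congrArg (Subtype.val : ℤ_[p] → ℚ_[p]) hc
        change ‖(((p : ℚ)⁻¹ : ℚ) : ℚ_[p]) * (z ⟨p, hp⟩ - ((n : ℚ) : ℚ_[p]))‖ ≤ 1
        rw [hc', Rat.cast_inv, Rat.cast_natCast,
          inv_mul_cancel_left₀ (by exact_mod_cast hp.ne_zero)]
        exact c.2
      · have h1 := norm_cast_prime ⟨p, hp⟩ l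
        rw [if_neg h] at h1
        rw [RestrictedProduct.mul_apply, norm_mul, finDiag_apply, Rat.cast_inv, norm_inv,
          Rat.cast_natCast, h1, inv_one, one_mul]
        exact integralSubring.sub_mem hz (finDiag_natCast_mem n) l
    · rw [← mul_assoc, ← map_mul, mul_inv_cancel₀ hp0, map_one, one_mul, Int.cast_natCast,
        add_sub_cancel]
  | mul a b iha ihb =>
    obtain ⟨ha, hb⟩ : 0 < a ∧ 0 < b := by
      constructor <;> refine Nat.pos_of_ne_zero ?_ <;> rintro rfl <;> simp at hM
    obtain ⟨i, w, hw, rfl⟩ := iha ha z hz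
    obtain ⟨j, v, hv, rfl⟩ := ihb hb w hw
    refine ⟨i + a * j, v, hv, ?_⟩
    push_cast
    simp only [map_add, map_mul]
    ring

/-- Strong approximation. After clearing a denominator `D`, the approximation is made modulo `D *
N`, so that modulus `N` remains after dividing by `D`. -/
theorem exists_rat_add_mul (N : ℕ) (hN : 0 < N) (x : FinAdele) :
    ∃ a : ℚ, ∃ w ∈ integralSubring, x = finDiag a + finDiag N * w := by
  obtain ⟨D, hD, hx⟩ := exists_nat_mul_mem x
  obtain ⟨j, w, hw, h⟩ := exists_int_add_mul (D * N) (Nat.mul_pos hD hN) _ hx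
  refine ⟨j / D, w, hw, ?_⟩
  have hD' : finDiag (D : ℚ)⁻¹ * finDiag (D : ℚ) = 1 := by
    rw [← map_mul, inv_mul_cancel₀ (by exact_mod_cast hD.ne'), map_one]
  calc x = finDiag (D : ℚ)⁻¹ * (finDiag D * x) := by rw [← mul_assoc, hD', one_mul]
    _ = finDiag (j / D) + finDiag N * w := by
      rw [h, Nat.cast_mul, map_mul, mul_add, ← map_mul, mul_assoc (finDiag (D : ℚ)),
        ← mul_assoc (finDiag (D : ℚ)⁻¹), hD', one_mul, div_eq_mul_inv, mul_comm (j : ℚ)]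

/-! ### The standard character of the finite adeles -/

/-- The finite part of the standard character. -/
def finChar (x : FinAdele) : ℂ := ∏ᶠ p : Nat.Primes, padicChar (p : ℕ) (x p)

theorem stdChar_eq (x : Adele) : stdChar x = finChar x.1 * realChar x.2 := rfl

theorem padicFract_of_norm_le_one (p : ℕ) [Fact p.Prime] {x : ℚ_[p]} (hx : ‖x‖ ≤ 1) :
    padicFract p x = 0 := by
  have h : (-x.valuation).toNat = 0 := by
    have := (Padic.norm_le_one_iff_val_nonneg x).1 hx
    omega
  simp [padicFract, h, PadicInt.appr]

/-- `pᵏ x` agrees with its first `k` digits modulo `pᵏ`; dividing by `pᵏ` leaves a `p`-adic integer.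
-/
theorem norm_sub_padicFract_le (p : ℕ) [Fact p.Prime] (x : ℚ_[p]) :
    ‖x - (padicFract p x : ℚ_[p])‖ ≤ 1 := by
  set k := (-x.valuation).toNat with hk
  have hp : (p : ℚ_[p]) ^ k ≠ 0 := pow_ne_zero _ (by exact_mod_cast (Fact.out : p.Prime).ne_zero)
  have h := PadicInt.appr_spec k (padicScale p x)
  rw [← PadicInt.norm_le_pow_iff_mem_span_pow] at h
  have h' : ‖(p : ℚ_[p]) ^ k * x - (PadicInt.appr (padicScale p x) k : ℚ_[p])‖ ≤
      (p : ℝ) ^ (-(k : ℤ)) := by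
    rwa [PadicInt.norm_def, PadicInt.coe_sub, PadicInt.coe_natCast] at h
  have e : x - (padicFract p x : ℚ_[p]) = ((p : ℚ_[p]) ^ k)⁻¹ *
      ((p : ℚ_[p]) ^ k * x - (PadicInt.appr (padicScale p x) k : ℚ_[p])) := by
    rw [mul_sub, inv_mul_cancel_left₀ hp, padicFract, ← hk]
    push_cast
    rw [div_eq_inv_mul]
  rw [e, norm_mul, norm_inv, norm_pow, Padic.norm_p, inv_pow, inv_inv]
  have hpos : (0 : ℝ) < (p : ℝ) ^ k := pow_pos (by exact_mod_cast (Fact.out : p.Prime).pos) _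
  calc _ ≤ (p : ℝ) ^ k * (p : ℝ) ^ (-(k : ℤ)) := by gcongr
    _ = 1 := by rw [zpow_neg, zpow_natCast, mul_inv_cancel₀ hpos.ne']

theorem norm_padicFract_le_one (p l : Nat.Primes) (h : l ≠ p) (x : ℚ_[(p : ℕ)]) :
    ‖(padicFract (p : ℕ) x : ℚ_[(l : ℕ)])‖ ≤ 1 := by
  rw [padicFract]
  push_cast
  rw [norm_div, norm_pow, norm_cast_prime, if_neg h, one_pow, div_one]
  exact_mod_cast Padic.norm_int_le_one (p := (l : ℕ)) (PadicInt.appr _ _ : ℤ)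

/-- The character only depends on the class modulo the integral adeles. -/
theorem finChar_eq (x : FinAdele) (r : ℚ) (h : x - finDiag r ∈ integralSubring) :
    finChar x = Complex.exp (2 * Real.pi * Complex.I * r) := by
  set S : Finset Nat.Primes := (show Set.Finite {p | ¬ ‖x p‖ ≤ 1} from
    eventually_norm_le_one x).toFinset with hS
  have hmem : ∀ p, p ∉ S → ‖x p‖ ≤ 1 := fun p hp => by
    simpa [hS] using hp
  have hc : finChar x = Complex.exp (2 * Real.pi * Complex.I *
      ((∑ p ∈ S, padicFract (p : ℕ) (x p) : ℚ) : ℂ)) := by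
    rw [finChar, finprod_eq_prod_of_mulSupport_subset (s := S)]
    · push_cast
      rw [Finset.mul_sum, Complex.exp_sum]
      rfl
    · intro p hp
      by_contra hpS
      exact hp (by simp [padicChar, padicFract_of_norm_le_one _ (hmem p hpS)])
  -- Both `r` and the sum of the fractional parts differ from `x` by an integral adele, hence from
  -- each other by an integer, which the exponential does not see.
  have hi : finDiag ((∑ p ∈ S, padicFract (p : ℕ) (x p)) - r) ∈ integralSubring := by
    have : x - finDiag (∑ p ∈ S, padicFract (p : ℕ) (x p)) ∈ integralSubring := by
      refine mem_integralSubring_iff.2 fun l => ?_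
      have key : ∀ T : Finset Nat.Primes, l ∉ T →
          ‖((∑ p ∈ T, padicFract (p : ℕ) (x p) : ℚ) : ℚ_[(l : ℕ)])‖ ≤ 1 := by
        intro T hT
        push_cast
        refine (PadicInt.subring (l : ℕ)).sum_mem fun p hp => ?_
        exact norm_padicFract_le_one p l (fun h => hT (h ▸ hp)) _
      change ‖x l - ((∑ p ∈ S, padicFract (p : ℕ) (x p) : ℚ) : ℚ_[(l : ℕ)])‖ ≤ 1
      by_cases hl : l ∈ S
      · rw [← Finset.add_sum_erase S _ hl, Rat.cast_add, ← sub_sub]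
        exact (PadicInt.subring (l : ℕ)).sub_mem (norm_sub_padicFract_le _ _)
          (key _ (Finset.notMem_erase _ _))
      · exact (PadicInt.subring (l : ℕ)).sub_mem (hmem l hl) (key _ hl)
    have h2 := integralSubring.sub_mem h this
    rwa [sub_sub_sub_cancel_left, ← map_sub] at h2
  obtain ⟨n, hn⟩ := exists_intCast_of_finDiag_mem hi
  rw [hc, Complex.exp_eq_exp_iff_exists_int]
  refine ⟨n, ?_⟩
  rw [sub_eq_iff_eq_add] at hn
  rw [hn]
  push_cast
  ring

theorem finChar_finDiag (r : ℚ) : finChar (finDiag r) = Complex.exp (2 * Real.pi * Complex.I * r) :=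
  finChar_eq _ _ (by simp)

theorem finChar_of_mem {x : FinAdele} (h : x ∈ integralSubring) : finChar x = 1 := by
  simpa using finChar_eq x 0 (by simpa using h)

theorem exists_rat_sub_mem (x : FinAdele) : ∃ r : ℚ, x - finDiag r ∈ integralSubring := by
  obtain ⟨a, w, hw, h⟩ := exists_rat_add_mul 1 one_pos x
  exact ⟨a, by simpa [h] using hw⟩

/-- Passing to rational representatives avoids the carries in the digits of a sum. -/
theorem finChar_add (x y : FinAdele) : finChar (x + y) = finChar x * finChar y := by
  obtain ⟨r, hr⟩ := exists_rat_sub_mem x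
  obtain ⟨s, hs⟩ := exists_rat_sub_mem y
  rw [finChar_eq x r hr, finChar_eq y s hs, finChar_eq (x + y) (r + s), ← Complex.exp_add]
  · push_cast; ring_nf
  · rw [map_add, add_sub_add_comm]; exact add_mem hr hs

theorem norm_finChar (x : FinAdele) : ‖finChar x‖ = 1 := by
  obtain ⟨r, hr⟩ := exists_rat_sub_mem x
  rw [finChar_eq x r hr]
  convert Complex.norm_exp_ofReal_mul_I (2 * Real.pi * r) using 2
  push_cast; ring_nf

theorem mem_of_finChar_eq_one {x : FinAdele} (h : finChar x = 1) : x ∈ integralSubring := by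
  obtain ⟨r, hr⟩ := exists_rat_sub_mem x
  rw [finChar_eq x r hr, Complex.exp_eq_one_iff] at h
  obtain ⟨n, hn⟩ := h
  have : (r : ℂ) = n := by
    have h2 := Complex.two_pi_I_ne_zero
    exact mul_left_cancel₀ h2 (by rw [hn]; ring)
  have : r = n := by exact_mod_cast this
  rw [this] at hr
  simpa using add_mem hr (finDiag_intCast_mem n)


/-! ### Cosets of `N ∏_p ℤ_p` and their volume -/

/-- The coset `a + N ∏_p ℤ_p` in the finite adeles. -/
def coset (a : ℚ) (N : ℕ) : Set FinAdele :=
  {x | finDiag (N : ℚ)⁻¹ * (x - finDiag a) ∈ integralSubring}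

theorem mem_coset {a : ℚ} {N : ℕ} {x : FinAdele} :
    x ∈ coset a N ↔ finDiag (N : ℚ)⁻¹ * (x - finDiag a) ∈ integralSubring := Iff.rfl

theorem finDiag_inv_mul {q : ℚ} (hq : q ≠ 0) : finDiag q⁻¹ * finDiag q = 1 := by
  rw [← map_mul, inv_mul_cancel₀ hq, map_one]

theorem finDiag_mem_coset_iff {a q : ℚ} {N : ℕ} (hN : 0 < N) :
    finDiag q ∈ coset a N ↔ ∃ m : ℤ, q = a + N * m := by
  have hN' : (N : ℚ) ≠ 0 := by exact_mod_cast hN.ne'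
  rw [mem_coset, ← map_sub, ← map_mul]
  constructor
  · intro h
    obtain ⟨m, hm⟩ := exists_intCast_of_finDiag_mem h
    refine ⟨m, ?_⟩
    rw [← hm, mul_inv_cancel_left₀ hN']
    ring
  · rintro ⟨m, rfl⟩
    rw [add_sub_cancel_left, inv_mul_cancel_left₀ hN']
    exact finDiag_intCast_mem m

theorem isOpen_coset (a : ℚ) (N : ℕ) : IsOpen (coset a N) :=
  isOpen_integralAdeles.preimage
    (f := fun x : FinAdele => finDiag (N : ℚ)⁻¹ * (x - finDiag a)) (by fun_prop)

theorem measurableSet_coset (a : ℚ) (N : ℕ) : MeasurableSet (coset a N) :=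
  (isOpen_coset a N).measurableSet

instance : finHaar.IsAddHaarMeasure :=
  Measure.isAddHaarMeasure_addHaarMeasure integralPositiveCompacts

/-- The sets `(n + 1)⁻¹ ∏_p ℤ_p` exhaust the finite adeles. This makes `finHaar` σ-finite, so that
Fubini applies to `adeleHaar`. -/
instance : SigmaCompactSpace FinAdele where
  isSigmaCompact_univ := by
    refine ⟨fun n => (fun z => finDiag ((n + 1 : ℕ) : ℚ)⁻¹ * z) '' integralAdeles,
      fun n => isCompact_integralAdeles.image (by fun_prop), ?_⟩
    refine Set.eq_univ_of_forall fun x => ?_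
    obtain ⟨N, hN, h⟩ := exists_nat_mul_mem x
    obtain ⟨n, rfl⟩ := Nat.exists_eq_add_of_lt hN
    refine Set.mem_iUnion.2 ⟨n, _, h, ?_⟩
    simp only [zero_add]
    rw [← mul_assoc, finDiag_inv_mul (by positivity), one_mul]

theorem finHaar_coset_eq (a : ℚ) (N : ℕ) : finHaar (coset a N) = finHaar (coset 0 N) := by
  have : coset a N = (fun x => x + -finDiag a) ⁻¹' coset 0 N := by
    ext x
    simp [mem_coset, sub_eq_add_neg]
  rw [this, measure_preimage_add_right]

theorem finHaar_integralAdeles : finHaar integralAdeles = 1 :=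
  Measure.addHaarMeasure_self (K₀ := integralPositiveCompacts)

theorem exists_lt_mem_coset {N : ℕ} (hN : 0 < N) {z : FinAdele} (hz : z ∈ integralSubring) :
    ∃ j < N, z ∈ coset j N := by
  obtain ⟨j, w, hw, rfl⟩ := exists_int_add_mul N hN z hz
  have hN' : (N : ℤ) ≠ 0 := by omega
  have hj := Int.emod_nonneg j hN'
  obtain ⟨k, hk⟩ := Int.eq_ofNat_of_zero_le hj
  refine ⟨k, by have := Int.emod_lt_of_pos j (by omega : (0 : ℤ) < N); omega, ?_⟩
  have hjk : (j : ℚ) = k + N * ((j / N : ℤ) : ℚ) := by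
    have := Int.emod_add_mul_ediv j N
    rw [hk] at this
    exact_mod_cast this.symm
  rw [mem_coset, hjk, map_add, map_mul]
  have : finDiag (k : ℚ) + finDiag (N : ℚ) * finDiag ((j / N : ℤ) : ℚ) + finDiag N * w -
      finDiag (k : ℚ) = finDiag (N : ℚ) * (finDiag ((j / N : ℤ) : ℚ) + w) := by ring
  rw [this, ← mul_assoc, finDiag_inv_mul (by exact_mod_cast hN.ne'), one_mul]
  exact add_mem (finDiag_intCast_mem _) hw

theorem eq_of_mem_coset {N i j : ℕ} (hi : i < N) (hj : j < N) {z : FinAdele}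
    (hzi : z ∈ coset i N) (hzj : z ∈ coset j N) : i = j := by
  have h := sub_mem (mem_coset.1 hzj) (mem_coset.1 hzi)
  rw [← mul_sub, sub_sub_sub_cancel_left, ← map_sub] at h
  have h' : finDiag i ∈ coset j N := by rwa [mem_coset, ← map_sub]
  obtain ⟨m, hm⟩ := (finDiag_mem_coset_iff (by omega)).1 h'
  have hm' : (i : ℤ) = j + N * m := by exact_mod_cast hm
  have := congrArg (· % (N : ℤ)) hm'
  simp only [Int.add_mul_emod_self_left] at this
  rw [Int.emod_eq_of_lt, Int.emod_eq_of_lt] at this <;> omega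

/-- `N` translates of equal volume partition `∏_p ℤ_p`, which has volume `1`. -/
theorem finHaar_coset (a : ℚ) {N : ℕ} (hN : 0 < N) : finHaar (coset a N) = (N : ENNReal)⁻¹ := by
  have hU : integralAdeles = ⋃ j ∈ Finset.range N, coset j N := by
    ext z
    simp only [Set.mem_iUnion, Finset.mem_range, exists_prop]
    refine ⟨exists_lt_mem_coset hN, ?_⟩
    rintro ⟨j, -, h⟩
    have h2 := add_mem (mul_mem (finDiag_natCast_mem N) h) (finDiag_natCast_mem j)
    rwa [← mul_assoc, ← map_mul, mul_inv_cancel₀ (by exact_mod_cast hN.ne'), map_one, one_mul,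
      sub_add_cancel] at h2
  have h1 := finHaar_integralAdeles
  rw [hU, measure_biUnion_finset _ fun j _ => measurableSet_coset _ _] at h1
  · simp_rw [fun j : ℕ => finHaar_coset_eq j N] at h1
    rw [Finset.sum_const, Finset.card_range, nsmul_eq_mul] at h1
    rw [finHaar_coset_eq]
    exact ENNReal.eq_inv_of_mul_eq_one_left (by rwa [mul_comm])
  · intro i hi j hj hij
    refine Set.disjoint_left.2 fun z hzi hzj => hij ?_
    exact eq_of_mem_coset (Finset.mem_range.1 hi) (Finset.mem_range.1 hj) hzi hzj

/-! ### Fourier transforms of cosets -/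

theorem continuous_finChar : Continuous finChar := by
  refine IsLocallyConstant.continuous ((IsLocallyConstant.iff_exists_open _).2 fun x => ?_)
  refine ⟨(fun y => y - x) ⁻¹' integralAdeles, isOpen_integralAdeles.preimage (by fun_prop), ?_,
    fun y hy => ?_⟩
  · rw [Set.mem_preimage, sub_self]
    exact integralSubring.zero_mem
  · rw [← sub_add_cancel y x, finChar_add, finChar_of_mem hy, one_mul]

theorem integrable_indicator_coset (a : ℚ) {N : ℕ} (hN : 0 < N) :
    Integrable ((coset a N).indicator (1 : FinAdele → ℂ)) finHaar := by
  refine (integrable_indicator_iff (measurableSet_coset a N)).2 (integrableOn_const ?_)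
  rw [finHaar_coset a hN]
  simpa using hN.ne'

theorem integrable_indicator_coset_mul_finChar (a : ℚ) {N : ℕ} (hN : 0 < N) (t : FinAdele) :
    Integrable (fun x => (coset a N).indicator (1 : FinAdele → ℂ) x * finChar (t * x)) finHaar := by
  refine (integrable_indicator_coset a hN).mul_bdd (c := 1) ?_ ?_
  · exact (continuous_finChar.comp (continuous_const.mul continuous_id)).aestronglyMeasurable
  · exact ae_of_all _ fun x => (norm_finChar _).le

/-- Here `x ↦ finChar (t * x)` is constant on the coset, so the integral is its value times the
volume. -/
theorem integral_indicator_coset_mul_finChar_of_mem (a : ℚ) {N : ℕ} (hN : 0 < N) {t : FinAdele}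
    (ht : finDiag N * t ∈ integralSubring) :
    ∫ x, (coset a N).indicator (1 : FinAdele → ℂ) x * finChar (t * x) ∂finHaar =
      finChar (t * finDiag a) * (N : ℂ)⁻¹ := by
  have : ∀ x, (coset a N).indicator (1 : FinAdele → ℂ) x * finChar (t * x) =
      (coset a N).indicator (fun _ => finChar (t * finDiag a)) x := by
    intro x
    by_cases hx : x ∈ coset a N
    · rw [Set.indicator_of_mem hx, Set.indicator_of_mem hx, Pi.one_apply, one_mul]
      have e : t * x = t * finDiag a +
          finDiag N * t * (finDiag (N : ℚ)⁻¹ * (x - finDiag a)) := by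
        rw [mul_mul_mul_comm, ← map_mul, mul_inv_cancel₀ (by exact_mod_cast hN.ne'), map_one]
        ring
      rw [e, finChar_add, finChar_of_mem (mul_mem ht hx), mul_one]
    · rw [Set.indicator_of_notMem hx, Set.indicator_of_notMem hx, zero_mul]
  simp_rw [this]
  rw [integral_indicator_const _ (measurableSet_coset a N), Measure.real, finHaar_coset a hN]
  simp [mul_comm]

/-- Translation by `N` preserves the coset and multiplies the integrand by `finChar (N t)`, which is
not `1` because the kernel of `finChar` is no larger than `∏_p ℤ_p`. -/
theorem integral_indicator_coset_mul_finChar_of_notMem (a : ℚ) {N : ℕ} (hN : 0 < N) {t : FinAdele}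
    (ht : finDiag N * t ∉ integralSubring) :
    ∫ x, (coset a N).indicator (1 : FinAdele → ℂ) x * finChar (t * x) ∂finHaar = 0 := by
  set F : FinAdele → ℂ := fun x => (coset a N).indicator (1 : FinAdele → ℂ) x * finChar (t * x)
    with hF
  have hshift : ∀ x, F (x + finDiag N) = finChar (finDiag N * t) * F x := by
    intro x
    have hmem : x + finDiag N ∈ coset a N ↔ x ∈ coset a N := by
      rw [mem_coset, mem_coset, add_sub_right_comm, mul_add,
        finDiag_inv_mul (by exact_mod_cast hN.ne'), add_mem_cancel_right (one_mem _)]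
    have hind : (coset a N).indicator (1 : FinAdele → ℂ) (x + finDiag N) =
        (coset a N).indicator 1 x := by
      by_cases hx : x ∈ coset a N
      · rw [Set.indicator_of_mem hx, Set.indicator_of_mem (hmem.2 hx)]; rfl
      · rw [Set.indicator_of_notMem hx, Set.indicator_of_notMem (mt hmem.1 hx)]
    simp only [hF]
    rw [hind, mul_add, finChar_add, mul_comm t (finDiag N)]
    ring
  have h := integral_add_right_eq_self (μ := finHaar) F (finDiag N)
  simp_rw [hshift] at h
  rw [integral_const_mul] at h
  by_contra hne
  exact ht (mem_of_finChar_eq_one (mul_right_cancel₀ hne (by rw [h, one_mul])))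

/-! ### The real character and Fourier transforms of coset tensors -/

theorem continuous_realChar : Continuous realChar := by
  unfold realChar
  fun_prop

theorem norm_realChar (x : ℝ) : ‖realChar x‖ = 1 := by
  rw [realChar]
  convert Complex.norm_exp_ofReal_mul_I (-2 * Real.pi * x) using 2
  push_cast; ring_nf

theorem integrable_mul_realChar (g : 𝓢(ℝ, ℂ)) (t : ℝ) :
    Integrable (fun x => g x * realChar (t * x)) := by
  refine g.integrable.mul_bdd (c := 1) ?_ ?_
  · exact (continuous_realChar.comp (continuous_const.mul continuous_id)).aestronglyMeasurable
  · exact ae_of_all _ fun x => (norm_realChar _).le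

open FourierTransform in
theorem integral_mul_realChar (g : 𝓢(ℝ, ℂ)) (t : ℝ) :
    ∫ x, g x * realChar (t * x) = 𝓕 (g : ℝ → ℂ) t := by
  rw [Real.fourier_real_eq_integral_exp_smul]
  refine integral_congr_ae (ae_of_all _ fun x => ?_)
  simp only [realChar, smul_eq_mul]
  rw [mul_comm]
  congr 2
  push_cast
  ring

/-- The product of the characteristic function of `a + N ∏_p ℤ_p` with a Schwartz function. -/
def cosetTensor (a : ℚ) (N : ℕ) (g : 𝓢(ℝ, ℂ)) : Adele → ℂ :=
  fun x => (coset a N).indicator 1 x.1 * g x.2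

theorem integrable_cosetTensor (a : ℚ) {N : ℕ} (hN : 0 < N) (g : 𝓢(ℝ, ℂ)) :
    Integrable (cosetTensor a N g) adeleHaar :=
  (integrable_indicator_coset a hN).mul_prod g.integrable

theorem cosetTensor_mul_stdChar (a : ℚ) (N : ℕ) (g : 𝓢(ℝ, ℂ)) (t x : Adele) :
    cosetTensor a N g x * stdChar (t * x) =
      ((coset a N).indicator 1 x.1 * finChar (t.1 * x.1)) * (g x.2 * realChar (t.2 * x.2)) := by
  rw [cosetTensor, stdChar_eq, Prod.fst_mul, Prod.snd_mul]
  ring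

theorem integrable_cosetTensor_mul_stdChar (a : ℚ) {N : ℕ} (hN : 0 < N) (g : 𝓢(ℝ, ℂ)) (t : Adele) :
    Integrable (fun x => cosetTensor a N g x * stdChar (t * x)) adeleHaar := by
  simp_rw [cosetTensor_mul_stdChar]
  exact (integrable_indicator_coset_mul_finChar a hN t.1).mul_prod (integrable_mul_realChar g t.2)

open FourierTransform in
theorem fourier_cosetTensor (a : ℚ) (N : ℕ) (g : 𝓢(ℝ, ℂ)) (t : Adele) :
    fourier (cosetTensor a N g) t =
      (∫ x, (coset a N).indicator (1 : FinAdele → ℂ) x * finChar (t.1 * x) ∂finHaar) *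
        𝓕 (g : ℝ → ℂ) t.2 := by
  rw [fourier]
  simp_rw [cosetTensor_mul_stdChar]
  rw [← integral_mul_realChar]
  exact integral_prod_mul
    (fun x : FinAdele => (coset a N).indicator (1 : FinAdele → ℂ) x * finChar (t.1 * x))
    (fun x : ℝ => g x * realChar (t.2 * x))

/-! ### Poisson summation on the real line -/

theorem summable_int_schwartz (g : 𝓢(ℝ, ℂ)) : Summable fun n : ℤ => g n :=
  summable_of_isBigO (Real.summable_abs_int_rpow one_lt_two)
    ((g.isBigO_cocompact_rpow (-2)).comp_tendsto Int.tendsto_coe_cofinite)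

/-- The function `x ↦ g (s x)` as a Schwartz function. -/
def schwartzScale (g : 𝓢(ℝ, ℂ)) {s : ℝ} (hs : s ≠ 0) : 𝓢(ℝ, ℂ) :=
  SchwartzMap.compCLMOfContinuousLinearEquiv ℂ
    (ContinuousLinearEquiv.unitsEquivAut ℝ (Units.mk0 s hs)) g

theorem schwartzScale_apply (g : 𝓢(ℝ, ℂ)) {s : ℝ} (hs : s ≠ 0) (x : ℝ) :
    schwartzScale g hs x = g (s * x) := by
  simp [schwartzScale, mul_comm]

open FourierTransform in
theorem fourier_schwartzScale (g : 𝓢(ℝ, ℂ)) {s : ℝ} (hs : s ≠ 0) (w : ℝ) :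
    𝓕 (schwartzScale g hs : ℝ → ℂ) w = (|s|⁻¹ : ℝ) * 𝓕 (g : ℝ → ℂ) (w / s) := by
  rw [← integral_mul_realChar, ← integral_mul_realChar, ← abs_inv, ← Complex.real_smul,
    ← Measure.integral_comp_mul_left (fun x => g x * realChar (w / s * x)) s]
  refine integral_congr_ae (ae_of_all _ fun x => ?_)
  simp only [schwartzScale_apply]
  congr 2
  field_simp

open FourierTransform in
/-- Poisson summation over an arithmetic progression. -/
theorem poisson_arithmetic_progression (g : 𝓢(ℝ, ℂ)) {s : ℝ} (hs : s ≠ 0) (b : ℝ) :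
    (Summable fun m : ℤ => g (b + s * m)) ∧
    (Summable fun m : ℤ =>
      Complex.exp (2 * Real.pi * Complex.I * (b / s * m)) * 𝓕 (g : ℝ → ℂ) (m / s)) ∧
    ∑' m : ℤ, g (b + s * m) = (|s|⁻¹ : ℝ) * ∑' m : ℤ,
      Complex.exp (2 * Real.pi * Complex.I * (b / s * m)) * 𝓕 (g : ℝ → ℂ) (m / s) := by
  -- Poisson summation for `x ↦ g (s x)`, evaluated at the point `b / s`.
  have h := SchwartzMap.tsum_eq_tsum_fourier (schwartzScale g hs) (b / s)
  have hF : ∀ n : ℤ, (𝓕 (schwartzScale g hs)) n * _root_.fourier n ((b / s : ℝ) : UnitAddCircle) =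
      (|s|⁻¹ : ℝ) * (Complex.exp (2 * Real.pi * Complex.I * (b / s * n)) *
        𝓕 (g : ℝ → ℂ) (n / s)) := by
    intro n
    rw [SchwartzMap.fourier_coe, fourier_schwartzScale, fourier_coe_apply]
    have : (2 * Real.pi * Complex.I * n * (b / s : ℝ) / (1 : ℝ) : ℂ) =
        2 * Real.pi * Complex.I * (b / s * n) := by
      push_cast; ring
    rw [this]
    ring
  have hL : ∀ n : ℤ, schwartzScale g hs (b / s + n) = g (b + s * n) := by
    intro n
    rw [schwartzScale_apply]
    congr 1
    field_simp
  simp_rw [hF, hL] at h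
  rw [tsum_mul_left] at h
  -- An equality of `tsum`s carries no convergence, so both summabilities are proved from Schwartz
  -- decay.
  refine ⟨?_, ?_, h⟩
  · refine (summable_int_schwartz
      ((schwartzScale g hs).compSubConstCLM ℂ (-(b / s)))).congr fun n => ?_
    rw [SchwartzMap.compSubConstCLM_apply, sub_neg_eq_add, add_comm, hL]
  · have hs' : ((|s|⁻¹ : ℝ) : ℂ) ≠ 0 := by simpa using hs
    refine (summable_mul_left_iff hs').1 ?_
    simp_rw [← hF]
    refine (summable_int_schwartz (𝓕 (schwartzScale g hs))).norm.of_norm_bounded fun n => ?_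
    rw [norm_mul, fourier_apply, Circle.norm_coe, mul_one]


/-! ### Poisson summation for cosets -/

/-- Integrability of `f` together with the summation formula for `f` at the idele `x`. -/
structure PoissonAt (x : Idele) (f : Adele → ℂ) : Prop where
  integrable : Integrable f adeleHaar
  -- Carried along because `PoissonAt.add` must split the integral defining `fourier`.
  integrable_mul_stdChar : ∀ t : Adele, Integrable (fun y => f y * stdChar (t * y)) adeleHaar
  summable : Summable fun r : ℚ => f (diag r * (x : Adele))
  summable_fourier : Summable fun q : ℚ => fourier f (diag q * ((x⁻¹ : Idele) : Adele))
  tsum_eq : ∑' r : ℚ, f (diag r * (x : Adele)) =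
    ((ideleAbs x)⁻¹ : ℝ) * ∑' q : ℚ, fourier f (diag q * ((x⁻¹ : Idele) : Adele))

theorem PoissonAt.zero (x : Idele) : PoissonAt x 0 where
  integrable := integrable_zero _ _ _
  integrable_mul_stdChar t := by simp
  summable := by simp
  summable_fourier := by simp [fourier]
  tsum_eq := by simp [fourier]

theorem PoissonAt.add {x : Idele} {f g : Adele → ℂ} (hf : PoissonAt x f) (hg : PoissonAt x g) :
    PoissonAt x (f + g) := by
  have h : ∀ t, fourier (f + g) t = fourier f t + fourier g t := by
    intro t
    simp only [fourier, Pi.add_apply, add_mul]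
    exact integral_add (hf.integrable_mul_stdChar t) (hg.integrable_mul_stdChar t)
  refine ⟨hf.integrable.add hg.integrable, fun t => ?_, hf.summable.add hg.summable, ?_, ?_⟩
  · simp only [Pi.add_apply, add_mul]
    exact (hf.integrable_mul_stdChar t).add (hg.integrable_mul_stdChar t)
  · simp_rw [h]
    exact hf.summable_fourier.add hg.summable_fourier
  · simp_rw [h, Pi.add_apply]
    rw [hf.summable.tsum_add hg.summable, hf.summable_fourier.tsum_add hg.summable_fourier,
      hf.tsum_eq, hg.tsum_eq, mul_add]

theorem PoissonAt.smul {x : Idele} {f : Adele → ℂ} (hf : PoissonAt x f) (c : ℂ) :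
    PoissonAt x (c • f) := by
  have h : ∀ t, fourier (c • f) t = c * fourier f t := by
    intro t
    simp only [fourier, Pi.smul_apply, smul_eq_mul, mul_assoc]
    exact integral_const_mul _ _
  refine ⟨hf.integrable.smul c, fun t => ?_, hf.summable.mul_left c, ?_, ?_⟩
  · simp only [Pi.smul_apply, smul_eq_mul, mul_assoc]
    exact (hf.integrable_mul_stdChar t).const_mul c
  · simp_rw [h]
    exact hf.summable_fourier.mul_left c
  · simp_rw [h, Pi.smul_apply, smul_eq_mul]
    rw [tsum_mul_left, tsum_mul_left, hf.tsum_eq, mul_left_comm]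

theorem PoissonAt.sum {x : Idele} {ι : Type*} (s : Finset ι) {f : ι → Adele → ℂ}
    (hf : ∀ i ∈ s, PoissonAt x (f i)) : PoissonAt x (∑ i ∈ s, f i) :=
  Finset.sum_induction f (PoissonAt x) (fun _ _ => PoissonAt.add) (PoissonAt.zero x) hf

/-! ### Ideles modulo units, and the formula for one coset -/

theorem idele_fst_mul_inv (x : Idele) : (x : Adele).1 * ((x⁻¹ : Idele) : Adele).1 = 1 := by
  rw [← Prod.fst_mul, Units.mul_inv, Prod.fst_one]

theorem idele_snd_ne_zero (x : Idele) : (x : Adele).2 ≠ 0 := by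
  intro h
  have := congrArg Prod.snd (Units.mul_inv x)
  rw [Prod.snd_mul, h, zero_mul] at this
  exact zero_ne_one this

theorem idele_inv_snd (x : Idele) : ((x⁻¹ : Idele) : Adele).2 = ((x : Adele).2)⁻¹ := by
  refine eq_inv_of_mul_eq_one_right ?_
  rw [← Prod.snd_mul, Units.mul_inv, Prod.snd_one]

/-- Up to units of `∏_p ℤ_p`, the finite part of an idele is a positive rational number. -/
theorem exists_rat_idele (x : Idele) :
    ∃ q : ℚ, 0 < q ∧ finDiag q * ((x⁻¹ : Idele) : Adele).1 ∈ integralSubring ∧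
      finDiag q⁻¹ * (x : Adele).1 ∈ integralSubring ∧
      ideleAbs x = (q : ℝ)⁻¹ * |(x : Adele).2| := by
  have hxy : ∀ p, ‖(x : Adele).1 p‖ * ‖((x⁻¹ : Idele) : Adele).1 p‖ = 1 := by
    intro p
    have := congrArg (fun z : FinAdele => ‖z p‖) (idele_fst_mul_inv x)
    simpa only [RestrictedProduct.mul_apply, norm_mul, RestrictedProduct.one_apply, norm_one]
      using this
  obtain ⟨q, hq, hn, hprod⟩ := exists_rat_norm_eq (x : Adele).1
    (fun p h => by have := hxy p; rw [h, norm_zero, zero_mul] at this; exact zero_ne_one this)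
    (by
      -- At almost every prime both `x_p` and its inverse have norm at most `1`, hence exactly `1`.
      filter_upwards [eventually_norm_le_one (x : Adele).1,
        eventually_norm_le_one ((x⁻¹ : Idele) : Adele).1] with p h1 h2
      have := hxy p
      have := norm_nonneg ((x : Adele).1 p)
      nlinarith)
  refine ⟨q, hq, mem_integralSubring_iff.2 fun p => ?_, mem_integralSubring_iff.2 fun p => ?_, ?_⟩
  · rw [RestrictedProduct.mul_apply, norm_mul, finDiag_apply, hn, hxy]
  · rw [RestrictedProduct.mul_apply, norm_mul, finDiag_apply, Rat.cast_inv, norm_inv, hn]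
    exact inv_mul_le_one
  · rw [ideleAbs, hprod]

theorem mem_iff_mul_mem {u v z : FinAdele} (hu : u ∈ integralSubring) (hv : v ∈ integralSubring)
    (huv : u * v = 1) : z ∈ integralSubring ↔ u * z ∈ integralSubring := by
  refine ⟨fun h => mul_mem hu h, fun h => ?_⟩
  have := mul_mem hv h
  rwa [← mul_assoc, mul_comm v, huv, one_mul] at this

theorem poissonAt_cosetTensor (x : Idele) (a : ℚ) {N : ℕ} (hN : 0 < N) (g : 𝓢(ℝ, ℂ)) :
    PoissonAt x (cosetTensor a N g) := by
  obtain ⟨q, hq, hu, hv, habs⟩ := exists_rat_idele x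
  have hxy := idele_fst_mul_inv x
  have hyinv := idele_inv_snd x
  have hy := idele_snd_ne_zero x
  set X : FinAdele := (x : Adele).1
  set Y : FinAdele := ((x⁻¹ : Idele) : Adele).1
  set y : ℝ := (x : Adele).2
  have hq0 : q ≠ 0 := hq.ne'
  have hN0 : (N : ℚ) ≠ 0 := by exact_mod_cast hN.ne'
  have hqq := finDiag_inv_mul hq0
  have hNN := finDiag_inv_mul hN0
  have huv : finDiag q * Y * (finDiag q⁻¹ * X) = 1 := by
    linear_combination X * Y * hqq + hxy
  -- With the unit `u = q Y`, the condition `r X ∈ a + N ∏_p ℤ_p` becomes `r q ∈ u a + N ∏_p ℤ_p`,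
  -- and `b` is a rational representative of `u a`.
  obtain ⟨b, w, hw, hb⟩ := exists_rat_add_mul N hN (finDiag q * Y * finDiag a)
  have hA : ∀ r : ℚ, finDiag r * X ∈ coset a N ↔ ∃ m : ℤ, r = (b + N * m) / q := by
    intro r
    have e : finDiag q * Y * (finDiag (N : ℚ)⁻¹ * (finDiag r * X - finDiag a)) =
        finDiag (N : ℚ)⁻¹ * (finDiag (r * q) - finDiag b) - w := by
      rw [map_mul]
      linear_combination finDiag (N : ℚ)⁻¹ * finDiag r * finDiag q * hxy -
        finDiag (N : ℚ)⁻¹ * hb - w * hNN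
    rw [mem_coset, mem_iff_mul_mem hu hv huv, e]
    have e2 : finDiag (N : ℚ)⁻¹ * (finDiag (r * q) - finDiag b) - w ∈ integralSubring ↔
        finDiag (r * q) ∈ coset b N :=
      ⟨fun h => by
        have h' := add_mem h hw
        rwa [sub_add_cancel] at h', fun h => sub_mem h hw⟩
    rw [e2, finDiag_mem_coset_iff hN]
    simp_rw [eq_div_iff hq0]
  have hB : ∀ r : ℚ, finDiag N * (finDiag r * Y) ∈ integralSubring ↔
      ∃ m : ℤ, r = q * m / N := by
    intro r
    have e : finDiag q⁻¹ * X * (finDiag N * (finDiag r * Y)) = finDiag (q⁻¹ * (N * r)) := by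
      rw [map_mul, map_mul]
      linear_combination finDiag q⁻¹ * finDiag N * finDiag r * hxy
    rw [mem_iff_mul_mem hv hu (by rw [mul_comm, huv]), e]
    constructor
    · intro h
      obtain ⟨m, hm⟩ := exists_intCast_of_finDiag_mem h
      refine ⟨m, ?_⟩
      rw [← hm]
      field_simp
    · rintro ⟨m, rfl⟩
      have : q⁻¹ * (N * (q * m / N)) = m := by field_simp
      rw [this]
      exact finDiag_intCast_mem m
  -- The real component of `r x` for `r = (b + N m) / q` is `b y / q + s m`.
  set s : ℝ := N * y / q with hs
  have hqR : (q : ℝ) ≠ 0 := by exact_mod_cast hq0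
  have hNR : (N : ℝ) ≠ 0 := by exact_mod_cast hN.ne'
  have hs0 : s ≠ 0 := div_ne_zero (mul_ne_zero hNR hy) hqR
  obtain ⟨hS1, hS2, hP⟩ := poisson_arithmetic_progression g hs0 (b * y / q)
  set e₁ : ℤ → ℚ := fun m => (b + N * m) / q with he₁
  set e₂ : ℤ → ℚ := fun m => q * m / N with he₂
  have inj₁ : Function.Injective e₁ := by
    intro m n h
    simpa [he₁, hq0, hN.ne'] using h
  have inj₂ : Function.Injective e₂ := by
    intro m n h
    simpa [he₂, hq0, hN.ne'] using h
  set F₁ : ℚ → ℂ := fun r => cosetTensor a N g (diag r * (x : Adele)) with hF₁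
  set F₂ : ℚ → ℂ := fun r => fourier (cosetTensor a N g) (diag r * ((x⁻¹ : Idele) : Adele)) with hF₂
  have supp₁ : ∀ r, r ∉ Set.range e₁ → F₁ r = 0 := by
    intro r hr
    have : (diag r * (x : Adele)).1 ∉ coset a N := fun h => by
      obtain ⟨m, hm⟩ := (hA r).1 h
      exact hr ⟨m, hm.symm⟩
    simp only [hF₁, cosetTensor]
    rw [Set.indicator_of_notMem this, zero_mul]
  have supp₂ : ∀ r, r ∉ Set.range e₂ → F₂ r = 0 := by
    intro r hr
    have : finDiag N * (diag r * ((x⁻¹ : Idele) : Adele)).1 ∉ integralSubring := fun h => by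
      obtain ⟨m, hm⟩ := (hB r).1 h
      exact hr ⟨m, hm.symm⟩
    simp only [hF₂]
    rw [fourier_cosetTensor, integral_indicator_coset_mul_finChar_of_notMem a hN this, zero_mul]
  have val₁ : F₁ ∘ e₁ = fun m : ℤ => g (b * y / q + s * m) := by
    funext m
    have : (diag (e₁ m) * (x : Adele)).1 ∈ coset a N := (hA _).2 ⟨m, rfl⟩
    simp only [Function.comp_apply, hF₁, cosetTensor]
    rw [Set.indicator_of_mem this, Pi.one_apply, one_mul, Prod.snd_mul, diag_snd]
    congr 1
    simp only [he₁, hs]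
    push_cast
    ring
  have val₂ : F₂ ∘ e₂ = fun m : ℤ => (N : ℂ)⁻¹ *
      (Complex.exp (2 * Real.pi * Complex.I * ((b * y / q : ℝ) / s * m)) *
        FourierTransform.fourier (g : ℝ → ℂ) (m / s)) := by
    funext m
    have hmem : finDiag N * (diag (e₂ m) * ((x⁻¹ : Idele) : Adele)).1 ∈ integralSubring :=
      (hB _).2 ⟨m, rfl⟩
    simp only [Function.comp_apply, hF₂]
    rw [fourier_cosetTensor, integral_indicator_coset_mul_finChar_of_mem a hN hmem]
    -- `(q m / N) Y a = (m / N) (b + N w)`: up to an integral adele the phase is that of the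
    -- rational `m b / N`, the one occurring in real Poisson summation.
    have e3 : (diag (e₂ m) * ((x⁻¹ : Idele) : Adele)).1 * finDiag a =
        finDiag (m * b / N) + finDiag m * w := by
      have h1 : e₂ m = m * (N : ℚ)⁻¹ * q := by simp only [he₂]; ring
      have h2 : m * b / N = m * (N : ℚ)⁻¹ * b := by ring
      change finDiag (e₂ m) * Y * finDiag a = _
      rw [h1, h2, map_mul, map_mul, map_mul, map_mul]
      linear_combination finDiag m * finDiag (N : ℚ)⁻¹ * hb + finDiag m * w * hNN
    rw [e3, finChar_add, finChar_of_mem (mul_mem (finDiag_intCast_mem m) hw), mul_one,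
      finChar_finDiag, Prod.snd_mul, diag_snd, hyinv]
    have e4 : ((e₂ m : ℚ) : ℝ) * y⁻¹ = m / s := by
      simp only [he₂, hs]
      push_cast
      field_simp
    have e5 : ((m * b / N : ℚ) : ℂ) = (b * y / q : ℝ) / s * m := by
      have : ((m * b / N : ℚ) : ℝ) = (b * y / q : ℝ) / s * m := by
        simp only [hs]
        push_cast
        field_simp
      exact_mod_cast congrArg (Complex.ofReal) this
    rw [e4, e5]
    ring
  refine ⟨integrable_cosetTensor a hN g, integrable_cosetTensor_mul_stdChar a hN g, ?_, ?_, ?_⟩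
  · rw [← inj₁.summable_iff supp₁, val₁]
    exact hS1
  · rw [← inj₂.summable_iff supp₂, val₂]
    exact hS2.mul_left _
  · have t₁ : ∑' r, F₁ r = ∑' m, (F₁ ∘ e₁) m :=
      (inj₁.tsum_eq (Function.support_subset_iff'.2 supp₁)).symm
    have t₂ : ∑' r, F₂ r = ∑' m, (F₂ ∘ e₂) m :=
      (inj₂.tsum_eq (Function.support_subset_iff'.2 supp₂)).symm
    rw [t₁, t₂, val₁, val₂, hP, tsum_mul_left, ← mul_assoc]
    congr 1
    -- `|s|⁻¹ = q / (N |y|)` is `|x|_𝔸⁻¹` times the coset volume `N⁻¹`.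
    rw [habs, hs, abs_div, abs_mul, Nat.abs_cast, abs_of_pos (by exact_mod_cast hq : (0 : ℝ) < q)]
    have hy' : ((|y| : ℝ) : ℂ) ≠ 0 := by exact_mod_cast (abs_pos.2 hy).ne'
    push_cast
    field_simp

/-! ### Decomposition of Bruhat functions -/

/-- A Lebesgue number for the cover of the support by fibres of `f` gives a uniform radius of
invariance. A single `B` bounds both its inverse and the support, so one integer can later control
both. -/
theorem exists_uniform_bound (p : ℕ) [Fact p.Prime] {f : ℚ_[p] → ℂ} (hf : IsLocallyConstant f)
    (hc : HasCompactSupport f) :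
    ∃ B : ℝ, (∀ x z, B * ‖z‖ ≤ 1 → f (x + z) = f x) ∧ ∀ x, f x ≠ 0 → ‖x‖ ≤ B := by
  obtain ⟨δ, hδ, h⟩ := lebesgue_number_lemma_of_metric (c := fun c : ℂ => f ⁻¹' {c}) hc
    (fun c => hf {c}) (fun x _ => Set.mem_iUnion.2 ⟨f x, rfl⟩)
  have h' : ∀ x ∈ tsupport f, ∀ y, dist y x < δ → f y = f x := by
    intro x hx y hy
    obtain ⟨c, hc⟩ := h x hx
    have h1 : f y = c := hc hy
    have h2 : f x = c := hc (Metric.mem_ball_self hδ)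
    rw [h1, h2]
  obtain ⟨R, hR⟩ := hc.isBounded.exists_norm_le
  -- The factor `2` turns `B * ‖z‖ ≤ 1` into the strict inequality `‖z‖ < δ`.
  refine ⟨max R (2 / δ), fun x z hz => ?_, fun x hx =>
    (hR x (subset_tsupport f hx)).trans (le_max_left _ _)⟩
  have hz' : ‖z‖ < δ := by
    have h1 : 2 / δ * ‖z‖ ≤ 1 :=
      (mul_le_mul_of_nonneg_right (le_max_right _ _) (norm_nonneg z)).trans hz
    rw [div_mul_eq_mul_div, div_le_one hδ] at h1
    linarith
  by_cases hx : x ∈ tsupport f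
  · exact h' x hx _ (by simpa [dist_eq_norm] using hz')
  by_cases hxz : x + z ∈ tsupport f
  · exact (h' _ hxz x (by simpa [dist_eq_norm] using hz')).symm
  · rw [image_eq_zero_of_notMem_tsupport hx, image_eq_zero_of_notMem_tsupport hxz]

/-- At almost all primes the bound `B p` is at most `1`, so some `N > 0` satisfies `B p * |N|_p ≤ 1`
everywhere. -/
theorem exists_level (f : ∀ p : Nat.Primes, ℚ_[(p : ℕ)] → ℂ)
    (hf : ∀ p, IsLocallyConstant (f p) ∧ HasCompactSupport (f p))
    (h1 : ∀ᶠ p in cofinite, f p =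
      Set.indicator ((PadicInt.subring (p : ℕ) : Subring ℚ_[(p : ℕ)]) : Set ℚ_[(p : ℕ)]) 1) :
    ∃ N : ℕ, 0 < N ∧
      (∀ x : FinAdele, ∀ z ∈ integralSubring,
        ∏ᶠ p, f p ((x + finDiag N * z) p) = ∏ᶠ p, f p (x p)) ∧
      ∀ x : FinAdele, ∏ᶠ p, f p (x p) ≠ 0 → finDiag N * x ∈ integralSubring := by
  have hB : ∀ p : Nat.Primes, ∃ B : ℝ, (∀ x z, B * ‖z‖ ≤ 1 → f p (x + z) = f p x) ∧
      (∀ x, f p x ≠ 0 → ‖x‖ ≤ B) ∧ (f p = Set.indicator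
        ((PadicInt.subring (p : ℕ) : Subring ℚ_[(p : ℕ)]) : Set ℚ_[(p : ℕ)]) 1 → B ≤ 1) := by
    intro p
    by_cases h : f p = Set.indicator
        ((PadicInt.subring (p : ℕ) : Subring ℚ_[(p : ℕ)]) : Set ℚ_[(p : ℕ)]) 1
    · refine ⟨1, fun x z hz => ?_, fun x hx => ?_, fun _ => le_rfl⟩
      · rw [one_mul] at hz
        have hm : x + z ∈ PadicInt.subring (p : ℕ) ↔ x ∈ PadicInt.subring (p : ℕ) :=
          add_mem_cancel_right hz
        rw [h]
        by_cases hx : x ∈ PadicInt.subring (p : ℕ)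
        · rw [Set.indicator_of_mem hx, Set.indicator_of_mem (hm.2 hx)]; rfl
        · rw [Set.indicator_of_notMem hx, Set.indicator_of_notMem (mt hm.1 hx)]
      · rw [h] at hx
        exact (Set.mem_of_indicator_ne_zero hx :
          x ∈ ((PadicInt.subring (p : ℕ) : Subring ℚ_[(p : ℕ)]) : Set ℚ_[(p : ℕ)]))
    · obtain ⟨B, h2, h3⟩ := exists_uniform_bound (p : ℕ) (hf p).1 (hf p).2
      exact ⟨B, h2, h3, fun h' => absurd h' h⟩
  choose B hB1 hB2 hB3 using hB
  obtain ⟨N, hN, hNB⟩ := exists_nat_mul_norm_le_one B (h1.mono hB3)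
  refine ⟨N, hN, fun x z hz => finprod_congr fun p => hB1 p _ _ ?_, fun x hx =>
    mem_integralSubring_iff.2 fun p => ?_⟩
  · have hz1 : ‖z p‖ ≤ 1 := hz p
    rw [RestrictedProduct.mul_apply, norm_mul, finDiag_apply, Rat.cast_natCast, ← mul_assoc]
    by_cases h0 : 0 ≤ B p
    · exact mul_le_one₀ (hNB p) (norm_nonneg _) hz1
    · have := mul_nonneg (norm_nonneg (N : ℚ_[(p : ℕ)])) (norm_nonneg (z p))
      rw [mul_assoc]
      nlinarith
  · rw [RestrictedProduct.mul_apply, norm_mul, finDiag_apply, Rat.cast_natCast]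
    -- Over an infinite `mulSupport` the `finprod` defaults to `1`; finiteness is what lets a
    -- vanishing factor kill the product.
    have hfin : (Function.mulSupport fun p => f p (x p)).Finite := by
      have : ∀ᶠ p in cofinite, f p (x p) = 1 := by
        filter_upwards [h1, eventually_norm_le_one x] with p hp hxp
        rw [hp]
        exact Set.indicator_of_mem (s := ((PadicInt.subring (p : ℕ) : Subring ℚ_[(p : ℕ)]) :
          Set ℚ_[(p : ℕ)])) hxp 1
      exact this
    have hne : f p (x p) ≠ 0 := by
      intro h0
      refine hx ?_
      rw [finprod_eq_prod _ hfin]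
      refine Finset.prod_eq_zero (i := p) ?_ h0
      rw [Set.Finite.mem_toFinset, Function.mem_mulSupport, h0]
      exact zero_ne_one
    rw [mul_comm]
    exact (mul_le_mul_of_nonneg_right (hB2 p _ hne) (norm_nonneg _)).trans (hNB p)

/-- Scaling by `N` turns the splitting of `N⁻¹ ∏_p ℤ_p` into cosets of `N ∏_p ℤ_p` into that of `∏_p
ℤ_p` modulo `N * N`. -/
theorem mem_coset_div_iff {N : ℕ} (hN : 0 < N) (j : ℚ) (x : FinAdele) :
    x ∈ coset (j / N) N ↔ finDiag N * x ∈ coset j (N * N) := by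
  have hNN := finDiag_inv_mul (show (N : ℚ) ≠ 0 by exact_mod_cast hN.ne')
  rw [mem_coset, mem_coset, Nat.cast_mul, mul_inv, map_mul, div_eq_inv_mul, map_mul]
  have : finDiag (N : ℚ)⁻¹ * finDiag (N : ℚ)⁻¹ * (finDiag N * x - finDiag j) =
      finDiag (N : ℚ)⁻¹ * (x - finDiag (N : ℚ)⁻¹ * finDiag j) := by
    linear_combination finDiag (N : ℚ)⁻¹ * x * hNN
  rw [this]

/-- A function of level `N` is a finite combination of characteristic functions of cosets. -/
theorem eq_sum_indicator_coset {φ : FinAdele → ℂ} {N : ℕ} (hN : 0 < N)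
    (hinv : ∀ x : FinAdele, ∀ z ∈ integralSubring, φ (x + finDiag N * z) = φ x)
    (hsupp : ∀ x : FinAdele, φ x ≠ 0 → finDiag N * x ∈ integralSubring) (x : FinAdele) :
    φ x = ∑ j ∈ Finset.range (N * N),
      φ (finDiag ((j : ℚ) / N)) * (coset ((j : ℚ) / N) N).indicator 1 x := by
  have hNN := finDiag_inv_mul (show (N : ℚ) ≠ 0 by exact_mod_cast hN.ne')
  have hval : ∀ a : ℚ, x ∈ coset a N → φ x = φ (finDiag a) := by
    intro a ha
    rw [← hinv (finDiag a) _ ha]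
    congr 1
    linear_combination (finDiag a - x) * hNN
  by_cases hx : φ x = 0
  · rw [hx, Finset.sum_eq_zero]
    intro j _
    by_cases hj : x ∈ coset ((j : ℚ) / N) N
    · rw [← hval _ hj, hx, zero_mul]
    · rw [Set.indicator_of_notMem hj, mul_zero]
  · obtain ⟨j, hj, hxj⟩ := exists_lt_mem_coset (Nat.mul_pos hN hN) (hsupp x hx)
    have hxj' := (mem_coset_div_iff hN _ _).2 hxj
    rw [Finset.sum_eq_single_of_mem j (Finset.mem_range.2 hj)]
    · rw [Set.indicator_of_mem hxj', Pi.one_apply, mul_one, hval _ hxj']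
    · intro i hi hij
      rw [Set.indicator_of_notMem, mul_zero]
      intro hxi
      exact hij (eq_of_mem_coset (Finset.mem_range.1 hi) hj ((mem_coset_div_iff hN _ _).1 hxi) hxj)

theorem poissonAt_bruhat_mul (x : Idele) (g : 𝓢(ℝ, ℂ)) {φ : FinAdele → ℂ} (hφ : φ ∈ bruhat) :
    PoissonAt x fun y => φ y.1 * g y.2 := by
  induction hφ using Submodule.span_induction with
  | mem φ h =>
    obtain ⟨f, hf, h1, rfl⟩ := h
    obtain ⟨N, hN, hinv, hsupp⟩ := exists_level f hf h1
    set φ : FinAdele → ℂ := fun x => ∏ᶠ p, f p (x p)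
    have : (fun y : Adele => φ y.1 * g y.2) = ∑ j ∈ Finset.range (N * N),
        φ (finDiag ((j : ℚ) / N)) • cosetTensor ((j : ℚ) / N) N g := by
      funext y
      rw [eq_sum_indicator_coset (φ := φ) hN hinv hsupp y.1, Finset.sum_mul, Finset.sum_apply]
      refine Finset.sum_congr rfl fun j _ => ?_
      rw [Pi.smul_apply, smul_eq_mul, cosetTensor, mul_assoc]
    rw [this]
    exact PoissonAt.sum _ fun j _ => (poissonAt_cosetTensor x _ hN g).smul _
  | zero =>
    convert PoissonAt.zero x using 1
    funext y
    exact zero_mul _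
  | add φ ψ _ _ h1 h2 =>
    convert h1.add h2 using 1
    funext y
    exact add_mul _ _ _
  | smul c φ _ h =>
    convert h.smul c using 1
    funext y
    exact mul_assoc _ _ _

theorem poissonAt_of_mem_bruhatSchwartz (x : Idele) {f : Adele → ℂ} (hf : f ∈ bruhatSchwartz) :
    PoissonAt x f := by
  induction hf using Submodule.span_induction with
  | mem f h =>
    obtain ⟨φ, hφ, g, rfl⟩ := h
    exact poissonAt_bruhat_mul x g hφ
  | zero => exact PoissonAt.zero x
  | add f g _ _ hf hg => exact hf.add hg
  | smul c f _ hf => exact hf.smul c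

theorem ideleAbs_one : ideleAbs 1 = 1 := by
  simp only [ideleAbs, Units.val_one, Prod.fst_one, Prod.snd_one, RestrictedProduct.one_apply,
    norm_one, finprod_one, abs_one, one_mul]

end

end Adelic

theorem mainTheorem3 (f : Adelic.Adele → ℂ) (hf : f ∈ Adelic.bruhatSchwartz) :
    Integrable f Adelic.adeleHaar ∧
    (Summable (fun r : ℚ => f (Adelic.diag r)) ∧
      Summable (fun q : ℚ => Adelic.fourier f (Adelic.diag q)) ∧
      ∑' r : ℚ, f (Adelic.diag r) = ∑' q : ℚ, Adelic.fourier f (Adelic.diag q)) ∧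
    ∀ x : Adelic.Idele,
      Summable (fun r : ℚ => f (Adelic.diag r * (x : Adelic.Adele))) ∧
      Summable (fun q : ℚ =>
        Adelic.fourier f (Adelic.diag q * ((x⁻¹ : Adelic.Idele) : Adelic.Adele))) ∧
      ∑' r : ℚ, f (Adelic.diag r * (x : Adelic.Adele)) =
        ((Adelic.ideleAbs x)⁻¹ : ℝ) *
          ∑' q : ℚ, Adelic.fourier f (Adelic.diag q * ((x⁻¹ : Adelic.Idele) : Adelic.Adele)) := by
  have h := Adelic.poissonAt_of_mem_bruhatSchwartz 1 hf
  have h1 := h.summable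
  have h2 := h.summable_fourier
  have h3 := h.tsum_eq
  simp only [inv_one, Units.val_one, mul_one, Adelic.ideleAbs_one, Complex.ofReal_one, one_mul]
    at h1 h2 h3
  refine ⟨h.integrable, ⟨h1, h2, h3⟩, fun x => ?_⟩
  have hx := Adelic.poissonAt_of_mem_bruhatSchwartz x hf
  exact ⟨hx.summable, hx.summable_fourier, hx.tsum_eq⟩
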